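/- Let $\mathcal{A}$ be a complex Banach algebra with identity $1$. For $S\subseteq\mathcal{A}$ let $S'=\{b\in\mathcal{A}: bs=sb \text{ for all } s\in S\}$, and $\{a\}''=(\{a\}')'$. Let $\mathcal{A}^{qnil}=\{a\in\mathcal{A}:\sigma(a)=\{0\}\}$. An element $a\in\mathcal{A}$ is generalized Drazin invertible if there is $x\in\{a\}'$ with $xax=x$ and $a-a^{2}x\in\mathcal{A}^{qnil}$. Let $\mathcal{A}^{acc}$ be the set of all $a\in\mathcal{A}$ such that $a-\lambda 1$ is generalized Drazin invertible for every $\lambda\in\mathbb{C}\setminus\{0\}$. An ag-Drazin inverse of $a$ is an element $x\in\{a\}'$ with $xax=x$ and $a-a^{2}x\in\mathcal{A}^{acc}$; $a$ is ag-Drazin invertible if it has an ag-Drazin inverse. Theorem. Let $a\in\mathcal{A}$. The following statements are equivalent. (1) $a$ is ag-Drazin invertible. (2) There exists an idempotent $p\in\{a\}''$ such that $a+p$ is invertible in $\mathcal{A}$ and $ap\in\mathcal{A}^{acc}$. (3) There exists an idempotent $p\in\{a\}'$ such that $a+p$ is invertible in $\mathcal{A}$ and $ap\in\mathcal{A}^{acc}$.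 Moreover, for every idempotent $p$ as in (2) or (3), the element $(a+p)^{-1}(1-p)$ is an ag-Drazin inverse of $a$. -/

import Mathlib

namespace AGDrazin

/-- The quasinilpotent elements: those whose spectrum is exactly `{0}`. -/
def qnil (A : Type*) [Ring A] [Algebra ℂ A] : Set A :=
  {a | spectrum ℂ a = {0}}

/-- `x` is a generalized Drazin inverse of `a`: `x` commutes with `a`, `x a x = x` and
`a - a² x` is quasinilpotent. -/
def IsGDrazinInverse {A : Type*} [Ring A] [Algebra ℂ A] (a x : A) : Prop :=
  x ∈ Set.centralizer {a} ∧ x * a * x = x ∧ a - a ^ 2 * x ∈ qnil A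

/-- The generalized Drazin invertible elements. -/
def gDrazin (A : Type*) [Ring A] [Algebra ℂ A] : Set A :=
  {a | ∃ x : A, IsGDrazinInverse a x}

/-- The elements `a` such that `a - λ 1` is generalized Drazin invertible for every `λ ≠ 0`. -/
def acc (A : Type*) [Ring A] [Algebra ℂ A] : Set A :=
  {a | ∀ z : ℂ, z ≠ 0 → a - algebraMap ℂ A z ∈ gDrazin A}

/-- `x` is an ag-Drazin inverse of `a`: `x` commutes with `a`, `x a x = x` and
`a - a² x` belongs to `acc A`. -/
def IsAGDrazinInverse {A : Type*} [Ring A] [Algebra ℂ A] (a x : A) : Prop :=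
  x ∈ Set.centralizer {a} ∧ x * a * x = x ∧ a - a ^ 2 * x ∈ acc A

/-- The ag-Drazin invertible elements. -/
def agDrazin (A : Type*) [Ring A] [Algebra ℂ A] : Set A :=
  {a | ∃ x : A, IsAGDrazinInverse a x}

end AGDrazin

/-! The substance is (1) → (2). Let `x` be an ag-Drazin inverse and `b = a - a ^ 2 * x`. Since `x`
need not double-commute with `a`, the idempotent `1 - a * x` must be replaced. In the commutative,
inverse-closed double commutant of `{a, x}`, the generalized Drazin inverses of the `b - z` isolate
the nonzero spectrum of `b`. By compactness, finitely many of their idempotents give `q` cutting out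
a small disc (`exists_idempotent_norm_lt`). Then `p = (1 - a * x) * q` is the spectral idempotent of
`a` for that disc. A growth estimate puts it in the double commutant of `a`
(`mem_bicommutant_of_tendsto`), and `a * p = p * b` stays in `acc` (`mul_mem_acc`). -/

namespace AGDrazin

open Filter Topology

/-! ### Power growth and membership in the double commutant. -/

section Norms

variable {A : Type*} [NormedRing A] [NormedAlgebra ℂ A] [CompleteSpace A]

theorem eventually_norm_pow_le {u : A} {s : NNReal} (h : spectralRadius ℂ u < s) :
    ∀ᶠ n : ℕ in atTop, ‖u ^ n‖ ≤ (s : ℝ) ^ n := by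
  have h1 := (spectrum.pow_nnnorm_pow_one_div_tendsto_nhds_spectralRadius u).eventually_lt_const h
  filter_upwards [h1, eventually_ge_atTop 1] with n hn hn1
  have h2 : ((‖u ^ n‖₊ : ENNReal) ^ (1 / n : ℝ)) ^ n ≤ (s : ENNReal) ^ n := by gcongr
  rw [← ENNReal.rpow_natCast, ← ENNReal.rpow_mul, one_div,
    inv_mul_cancel₀ (by positivity), ENNReal.rpow_one] at h2
  exact_mod_cast h2

theorem tendsto_norm_pow_mul_norm_pow {u y : A} {s t : NNReal} (hu : spectralRadius ℂ u < s)
    (hy : spectralRadius ℂ y < t) (hst : s * t < 1) :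
    Tendsto (fun n : ℕ => ‖u ^ n‖ * ‖y ^ n‖) atTop (𝓝 0) := by
  refine squeeze_zero' (.of_forall fun n => by positivity) ?_
    (tendsto_pow_atTop_nhds_zero_of_lt_one (r := (s * t : ℝ)) (by positivity)
      (by exact_mod_cast hst))
  filter_upwards [eventually_norm_pow_le hu, eventually_norm_pow_le hy] with n h1 h2
  rw [mul_pow]
  gcongr

theorem tendsto_norm_pow_mul_norm_pow_of_mem_qnil {u : A} (hu : u ∈ qnil A) (y : A) :
    Tendsto (fun n : ℕ => ‖u ^ n‖ * ‖y ^ n‖) atTop (𝓝 0) := by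
  obtain ⟨t, ht⟩ := ENNReal.lt_iff_exists_nnreal_btwn.1
    ((spectrum.spectralRadius_le_pow_nnnorm_pow_one_div ℂ y 0).trans_lt (by finiteness))
  have h0 : spectralRadius ℂ u = 0 := by
    have : spectrum ℂ u = {0} := hu
    simp [spectralRadius, this]
  refine tendsto_norm_pow_mul_norm_pow (s := (t + 1)⁻¹) ?_ ht.1 ?_
  · rw [h0]
    exact_mod_cast (by positivity : (0 : NNReal) < (t + 1)⁻¹)
  · rw [inv_mul_lt_iff₀ (by positivity)]
    simp

end Norms

/-- As `y` inverts `a` on the `1 - p` part, `p * c * (1 - p) = (a * p) ^ n * c * y ^ n` for `n ≥ 1`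
and `c` commuting with `a`. The limit kills it, and likewise the other corner. -/
theorem mem_bicommutant_of_tendsto {A : Type*} [NormedRing A] {a p y : A}
    (hp : p * p = p) (hap : a * p = p * a)
    (hya : y * a = 1 - p) (hay : a * y = 1 - p)
    (hlim : Tendsto (fun n : ℕ => ‖(a * p) ^ n‖ * ‖y ^ n‖) atTop (𝓝 0)) :
    p ∈ Set.centralizer (Set.centralizer {a}) := by
  have hpow : ∀ n : ℕ, 1 ≤ n → (a * p) ^ n = a ^ n * p := fun n hn => by
    rw [(show Commute a p from hap).mul_pow, IsIdempotentElem.pow_eq (n := n) hp (by omega)]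
  have hay' : Commute a y := hay.trans hya.symm
  have hpow' : ∀ n : ℕ, 1 ≤ n → a ^ n * y ^ n = 1 - p := fun n hn => by
    rw [← hay'.mul_pow, hay, IsIdempotentElem.pow_eq (n := n) (IsIdempotentElem.one_sub hp) (by omega)]
  have hzero : ∀ {v : A} {K : ℝ},
      (∀ n : ℕ, 1 ≤ n → ‖v‖ ≤ (‖(a * p) ^ n‖ * ‖y ^ n‖) * K) → v = 0 := fun {v K} h => by
    have h1 := hlim.mul_const K
    rw [zero_mul] at h1
    refine norm_le_zero_iff.1 (ge_of_tendsto h1 ?_)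
    filter_upwards [eventually_ge_atTop 1] with n hn using h n hn
  intro c hc
  have hca : Commute a c := hc a rfl
  have h1 : p * c * (1 - p) = 0 := hzero (K := ‖c‖) fun n hn => by
    have : p * c * (1 - p) = (a * p) ^ n * c * y ^ n := by
      rw [← hpow' n hn, hpow n hn, ← ((show Commute a p from hap).pow_left n).eq.symm,
        mul_assoc p c, ← mul_assoc c, ← (hca.pow_left n).eq]
      simp only [mul_assoc]
    rw [this]
    calc _ ≤ ‖(a * p) ^ n‖ * ‖c‖ * ‖y ^ n‖ := norm_mul₃_le ..
      _ = _ := by ring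
  have h2 : (1 - p) * c * p = 0 := hzero (K := ‖c‖) fun n hn => by
    have : (1 - p) * c * p = y ^ n * c * (a * p) ^ n := by
      rw [← hpow' n hn, hpow n hn, (hay'.pow_pow n n).eq, mul_assoc (y ^ n), (hca.pow_left n).eq]
      simp only [mul_assoc]
    rw [this]
    calc _ ≤ ‖y ^ n‖ * ‖c‖ * ‖(a * p) ^ n‖ := norm_mul₃_le ..
      _ = _ := by ring
  have h3 : p * c = p * c * p := by rw [mul_sub, mul_one, sub_eq_zero] at h1; exact h1
  have h4 : c * p = p * c * p := by
    rw [sub_mul, one_mul, sub_mul, sub_eq_zero] at h2; exact h2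
  rw [h3, h4]

theorem IsGDrazinInverse.mem_bicommutant {A : Type*} [NormedRing A] [NormedAlgebra ℂ A]
    [CompleteSpace A] {a x : A} (h : IsGDrazinInverse a x) :
    x ∈ Set.centralizer (Set.centralizer {a}) := by
  obtain ⟨hx, hxax, hq⟩ := h
  have hax : a * x = x * a := hx a rfl
  have hidem : (a * x) * (a * x) = a * x := by rw [mul_assoc, ← mul_assoc x, hxax]
  have he : 1 - a * x ∈ Set.centralizer (Set.centralizer {a}) := by
    have h1 : a * (1 - a * x) = a - a ^ 2 * x := by rw [mul_sub, mul_one, sq, mul_assoc]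
    refine mem_bicommutant_of_tendsto (y := x) (IsIdempotentElem.one_sub hidem) ?_ ?_ ?_ ?_
    · rw [mul_sub, sub_mul, mul_one, one_mul, mul_assoc a x a, hax]
    · rw [sub_sub_cancel, hax]
    · rw [sub_sub_cancel]
    · rw [h1]
      exact tendsto_norm_pow_mul_norm_pow_of_mem_qnil hq x
  intro c hc
  have hca : a * c = c * a := hc a rfl
  have hce : c * (a * x) = a * x * c := by
    have := he c hc
    rw [mul_sub, sub_mul, mul_one, one_mul] at this
    exact sub_right_injective this
  calc c * x = c * (x * a * x) := by rw [hxax]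
    _ = c * (a * x) * x := by rw [hax]; simp only [mul_assoc]
    _ = x * (a * c) * x := by rw [hce, hax]; simp only [mul_assoc]
    _ = x * (c * (a * x)) := by rw [hca]; simp only [mul_assoc]
    _ = x * a * x * c := by rw [hce]; simp only [mul_assoc]
    _ = x * c := by rw [hxax]

theorem algHom_idempotent_eq {R : Type*} [Ring R] [Algebra ℂ R] {p : R} (hp : p * p = p)
    (φ : R →ₐ[ℂ] ℂ) : φ p = 0 ∨ φ p = 1 := by
  have : φ p * φ p = φ p := by rw [← map_mul, hp]
  rcases eq_or_ne (φ p) 0 with h | h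
  · exact .inl h
  · exact .inr (mul_left_cancel₀ h (by rw [this, mul_one]))

/-! ### Separating the spectrum by characters in a commutative Banach algebra. -/

section Commutative

variable {B : Type*} [NormedCommRing B] [NormedAlgebra ℂ B] [CompleteSpace B]

theorem isUnit_of_forall_algHom_ne_zero {b : B} (h : ∀ φ : B →ₐ[ℂ] ℂ, φ b ≠ 0) : IsUnit b := by
  by_contra hb
  obtain ⟨f, hf⟩ := WeakDual.CharacterSpace.exists_apply_eq_zero hb
  exact h (WeakDual.CharacterSpace.toAlgHom f) hf

theorem exists_algHom_eq_of_mem_spectrum {b : B} {z : ℂ} (hz : z ∈ spectrum ℂ b) :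
    ∃ φ : B →ₐ[ℂ] ℂ, φ b = z := by
  obtain ⟨f, hf⟩ := WeakDual.CharacterSpace.mem_spectrum_iff_exists.1 hz
  exact ⟨WeakDual.CharacterSpace.toAlgHom f, hf⟩

/-- If every point outside the disc of radius `r` is separated from the rest of the spectrum of
`b` by an idempotent, then so is the whole disc. -/
theorem exists_idempotent_norm_lt {b : B} {r : ℝ} (hr : 0 < r)
    (h : ∀ z : ℂ, z ≠ 0 → ∃ e w : B, e * e = e ∧
      ∀ φ : B →ₐ[ℂ] ℂ, (φ e = 1 → φ b = z) ∧ (φ e = 0 → φ (b - algebraMap ℂ B z) * φ w = 1)) :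
    ∃ q : B, q * q = q ∧ ∀ φ : B →ₐ[ℂ] ℂ, (φ q = 1 → ‖φ b‖ < r) ∧ (φ q = 0 → r ≤ ‖φ b‖) := by
  choose! e w he hφ using h
  let K : Set ℂ := spectrum ℂ b \ Metric.ball 0 r
  have hK : IsCompact K := (spectrum.isCompact b).diff Metric.isOpen_ball
  have hne : ∀ z ∈ K, z ≠ 0 := by
    rintro z hz rfl
    exact hz.2 (by simpa using hr)
  -- If `φ (e z) = 0` then `‖φ b - z‖ * ‖φ (w z)‖ = 1`, so `φ b` is outside this ball. The norm of
  -- `1` is not assumed to be `1`.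
  let U : ℂ → Set ℂ := fun z => Metric.ball z (‖w z‖ * ‖(1 : B)‖ + 1)⁻¹
  obtain ⟨t, htK, ht⟩ := hK.elim_nhds_subcover U fun z _ =>
    Metric.ball_mem_nhds _ (by positivity)
  refine ⟨∏ z ∈ t, (1 - e z), ?_, fun φ => ⟨fun h1 => ?_, fun h0 => ?_⟩⟩
  · rw [← Finset.prod_mul_distrib]
    exact Finset.prod_congr rfl fun z hz => IsIdempotentElem.one_sub (he z (hne z (htK z hz)))
  · by_contra hlt
    have hmem : φ b ∈ K := ⟨AlgHom.apply_mem_spectrum φ b, by simpa using hlt⟩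
    obtain ⟨z, hzt, hz⟩ := Set.mem_iUnion₂.1 (ht hmem)
    have hz0 := hne z (htK z hzt)
    have hez : φ (e z) = 0 := by
      rcases algHom_idempotent_eq (he z hz0) φ with h | h
      · exact h
      · rw [map_prod, Finset.prod_eq_zero hzt (by simp [h])] at h1
        exact absurd h1 zero_ne_one
    have hw : ‖φ (w z)‖ ≤ ‖w z‖ * ‖(1 : B)‖ :=
      spectrum.norm_le_norm_mul_of_mem (AlgHom.apply_mem_spectrum φ _)
    have h2 := (hφ z hz0 φ).2 hez
    rw [map_sub, AlgHom.commutes] at h2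
    have h3 : ‖φ b - z‖ * ‖φ (w z)‖ = 1 := by
      have := congrArg norm h2
      simpa using this
    have h4 : ‖φ b - z‖ < (‖w z‖ * ‖(1 : B)‖ + 1)⁻¹ := by
      simpa [U, dist_eq_norm] using hz
    rw [← one_div, lt_div_iff₀ (by positivity)] at h4
    nlinarith [norm_nonneg (φ b - z)]
  · rw [map_prod, Finset.prod_eq_zero_iff] at h0
    obtain ⟨z, hzt, hz⟩ := h0
    have h1 : φ (e z) = 1 := by
      rw [map_sub, map_one, sub_eq_zero] at hz
      exact hz.symm
    rw [(hφ z (hne z (htK z hzt)) φ).1 h1]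
    simpa using (htK z hzt).2

theorem exists_idempotent_tendsto {a x : B} (hx : x * a * x = x)
    (h : ∀ z : ℂ, z ≠ 0 → ∃ w : B,
      w * (a - a ^ 2 * x - algebraMap ℂ B z) * w = w ∧
      ∀ φ : B →ₐ[ℂ] ℂ, φ (a - a ^ 2 * x - algebraMap ℂ B z
        - (a - a ^ 2 * x - algebraMap ℂ B z) ^ 2 * w) = 0) :
    ∃ p y : B, p * p = p ∧ y * a = 1 - p ∧ p * (a * x) = 0 ∧ IsUnit (a + p) ∧
      Tendsto (fun n : ℕ => ‖(a * p) ^ n‖ * ‖y ^ n‖) atTop (𝓝 0) := by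
  rcases subsingleton_or_nontrivial B with hB | hB
  · exact ⟨0, 0, Subsingleton.elim _ _, Subsingleton.elim _ _, Subsingleton.elim _ _,
      isUnit_of_subsingleton _, by simp [Subsingleton.elim (_ : B) 0]⟩
  set b := a - a ^ 2 * x with hb
  -- Where `φ (a * x) = 1`, this bound on `φ x` forces `r ≤ ‖φ a‖`; and `r ≤ 1` excludes `φ a = -1`
  -- where `φ p = 1`.
  set r : NNReal := (‖x‖₊ * ‖(1 : B)‖₊ + 1)⁻¹ with hrdef
  have hr : 0 < r := by positivity
  have hr1 : r ≤ 1 := inv_le_one_of_one_le₀ (by simp)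
  obtain ⟨q, hq, hqφ⟩ := exists_idempotent_norm_lt (b := b) (r := r) hr fun z hz => by
    obtain ⟨w, hw, hwφ⟩ := h z hz
    set d := b - algebraMap ℂ B z with hd
    refine ⟨1 - d * w, w, by linear_combination d * hw, fun φ => ⟨fun h1 => ?_, fun h0 => ?_⟩⟩
    · have h2 := hwφ φ
      have h3 : φ d = 0 := by
        rw [show d - d ^ 2 * w = d * (1 - d * w) by ring, map_mul, h1, mul_one] at h2
        exact h2
      rw [hd, map_sub, AlgHom.commutes, sub_eq_zero] at h3
      exact h3
    · rw [map_sub, map_one, map_mul, sub_eq_zero] at h0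
      exact h0.symm
  have hx0 : ∀ φ : B →ₐ[ℂ] ℂ, φ a * φ x = 0 ∨ φ a * φ x = 1 := fun φ => by
    rw [← map_mul]
    exact algHom_idempotent_eq (by linear_combination a * hx) φ
  have hbφ : ∀ φ : B →ₐ[ℂ] ℂ, φ b = φ a * (1 - φ a * φ x) := fun φ => by
    simp only [hb, map_sub, map_mul, map_pow]; ring
  set p := (1 - a * x) * q with hp
  have hpp : p * p = p := by
    rw [hp]; linear_combination (1 - a * x) ^ 2 * hq + q * a * hx
  have hpφ : ∀ φ : B →ₐ[ℂ] ℂ, (φ p = 1 ∧ ‖φ a‖ < r) ∨ (φ p = 0 ∧ r ≤ ‖φ a‖) := fun φ => by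
    have hφp : φ p = (1 - φ a * φ x) * φ q := by simp [hp]
    rcases hx0 φ with h0 | h1
    · have hba : φ b = φ a := by rw [hbφ, h0]; ring
      rw [hφp, h0, ← hba]
      rcases algHom_idempotent_eq hq φ with h | h
      · exact .inr ⟨by simp [h], (hqφ φ).2 h⟩
      · exact .inl ⟨by simp [h], (hqφ φ).1 h⟩
    · refine .inr ⟨by rw [hφp, h1]; ring, ?_⟩
      have hw : ‖φ x‖ ≤ ‖x‖ * ‖(1 : B)‖ :=
        spectrum.norm_le_norm_mul_of_mem (AlgHom.apply_mem_spectrum φ _)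
      have h3 : ‖φ a‖ * ‖φ x‖ = 1 := by
        have := congrArg norm h1
        simpa using this
      have : (r : ℝ) = (‖x‖ * ‖(1 : B)‖ + 1)⁻¹ := by simp [hrdef]
      rw [this, inv_le_iff_one_le_mul₀ (by positivity)]
      nlinarith [norm_nonneg (φ a)]
  have hunit : IsUnit (a + p) := isUnit_of_forall_algHom_ne_zero fun φ h0 => by
    rw [map_add] at h0
    rcases hpφ φ with ⟨h1, h2⟩ | ⟨h1, h2⟩
    · rw [eq_neg_of_add_eq_zero_left h0, h1, norm_neg, norm_one] at h2
      exact absurd (h2.trans_le (by exact_mod_cast hr1)) (lt_irrefl _)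
    · rw [h1, add_zero] at h0
      rw [h0, norm_zero] at h2
      exact absurd h2 (not_le.2 (by exact_mod_cast hr))
  obtain ⟨v, hv⟩ := hunit.exists_left_inv
  refine ⟨p, v * (1 - p), hpp, by linear_combination (1 - p) * hv + v * hpp, ?_, hunit, ?_⟩
  · rw [hp]; linear_combination - a * q * hx
  · have hap : spectralRadius ℂ (a * p) < r :=
      spectrum.spectralRadius_lt_of_forall_lt _ fun z hz => by
        obtain ⟨φ, rfl⟩ := exists_algHom_eq_of_mem_spectrum hz
        rcases hpφ φ with ⟨h1, h2⟩ | ⟨h1, h2⟩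
        · rw [map_mul, h1, mul_one]
          exact h2
        · simpa [h1] using hr
    obtain ⟨s, hs, hsr⟩ := ENNReal.lt_iff_exists_nnreal_btwn.1 hap
    -- The gap `s < s' < r` gives `s * s'⁻¹ < 1`, while `s'⁻¹` still exceeds the spectral radius of
    -- `y`.
    obtain ⟨s', hs', hsr'⟩ := exists_between (ENNReal.coe_lt_coe.1 hsr)
    have hs0 : 0 < s' := (zero_le (a := s)).trans_lt hs'
    refine tendsto_norm_pow_mul_norm_pow hs (t := s'⁻¹) ?_ ?_
    · refine spectrum.spectralRadius_lt_of_forall_lt _ fun z hz => ?_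
      obtain ⟨φ, rfl⟩ := exists_algHom_eq_of_mem_spectrum hz
      have hvφ : φ v * (φ a + φ p) = 1 := by rw [← map_add, ← map_mul, hv, map_one]
      rcases hpφ φ with ⟨h1, h2⟩ | ⟨h1, h2⟩
      · simpa [h1] using hs0
      · rw [h1, add_zero] at hvφ
        have h3 : ‖φ v‖₊ * ‖φ a‖₊ = 1 := by rw [← nnnorm_mul, hvφ, nnnorm_one]
        have h4 : s' < ‖φ a‖₊ := hsr'.trans_le h2
        rw [map_mul, map_sub, map_one, h1, sub_zero, mul_one, eq_inv_of_mul_eq_one_left h3]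
        exact inv_strictAnti₀ hs0 h4
    · rwa [← div_eq_mul_inv, div_lt_one hs0]

end Commutative

/-! ### Inverse-closedness of the double commutant. -/

section Bicommutant

variable {A : Type*} [NormedRing A] [NormedAlgebra ℂ A]

/-- The double commutant of a set, as a subalgebra. -/
abbrev bicommutant (S : Set A) : Subalgebra ℂ A := Subalgebra.centralizer ℂ S.centralizer

theorem isUnit_bicommutant_of_isUnit {S : Set A} (b : bicommutant S) (h : IsUnit (b : A)) :
    IsUnit b := by
  obtain ⟨u, hu⟩ := h
  have hmem : (↑u⁻¹ : A) ∈ bicommutant S := fun c hc => by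
    have hcu : Commute c (u : A) := by
      rw [hu]
      exact b.2 c hc
    exact hcu.units_inv_right.eq
  refine ⟨⟨b, ⟨_, hmem⟩, ?_, ?_⟩, rfl⟩
  · ext
    simp [← hu]
  · ext
    simp [← hu]

theorem algHom_eq_zero_of_mem_qnil {S : Set A} {b : bicommutant S} (h : (b : A) ∈ qnil A)
    (φ : bicommutant S →ₐ[ℂ] ℂ) : φ b = 0 := by
  by_contra h0
  have h1 : φ b ∉ spectrum ℂ (b : A) := by
    rw [show spectrum ℂ (b : A) = {0} from h]
    exact h0
  rw [spectrum.notMem_iff] at h1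
  have h2 : IsUnit (algebraMap ℂ (bicommutant S) (φ b) - b) := isUnit_bicommutant_of_isUnit _ h1
  have h3 := h2.map φ
  rw [map_sub, AlgHom.commutes] at h3
  simp at h3

end Bicommutant

theorem nontrivial_of_mem_qnil {A : Type*} [Ring A] [Algebra ℂ A] {c : A} (hc : c ∈ qnil A) : Nontrivial A := by
  by_contra hA
  rw [not_nontrivial_iff_subsingleton] at hA
  have h : (0 : ℂ) ∈ spectrum ℂ c := by
    rw [show spectrum ℂ c = {0} from hc]
    rfl
  exact h (isUnit_of_subsingleton _)

/-! ### Cutting down by a commuting idempotent; the idempotent of (2). -/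

section Ring

variable {A : Type*} [NormedRing A] [NormedAlgebra ℂ A] [CompleteSpace A]

theorem mul_mem_qnil {c p : A} (hc : c ∈ qnil A) (hp : p * p = p) (hcp : p * c = c * p) :
    p * c ∈ qnil A := by
  have := nontrivial_of_mem_qnil hc
  refine (Set.Nonempty.subset_singleton_iff (spectrum.nonempty (p * c))).1 fun z hz => ?_
  by_contra hz0
  have hz0 : z ≠ 0 := hz0
  have h1 : z ∉ spectrum ℂ c := by
    rw [show spectrum ℂ c = {0} from hc]
    exact hz0
  rw [spectrum.notMem_iff] at h1
  obtain ⟨v, h2, h3⟩ := isUnit_iff_exists.1 h1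
  refine hz (isUnit_iff_exists.2 ⟨v * p + z⁻¹ • (1 - p), ?_, ?_⟩)
  · have h4 : (algebraMap ℂ A z - p * c) * (v * p) = p := by
      have hv : Commute p v := by
        have h5 : Commute p (algebraMap ℂ A z - c) :=
          Commute.sub_right (Algebra.commutes z p).symm hcp
        obtain ⟨u, hu⟩ := h1
        have h6 : v = ↑u⁻¹ := (Units.inv_eq_of_mul_eq_one_right (by rw [hu, h2])).symm
        rw [h6]
        rw [← hu] at h5
        exact h5.units_inv_right
      calc _ = (algebraMap ℂ A z - p * c) * (p * v) := by rw [hv.eq]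
        _ = ((algebraMap ℂ A z - c) * v) * p := by
          rw [mul_assoc _ v, ← hv.eq, sub_mul, sub_mul, hcp, ← mul_assoc (c * p), mul_assoc c p p, hp,
            mul_assoc c p v]
        _ = p := by rw [h2, one_mul]
    have h5 : (algebraMap ℂ A z - p * c) * (z⁻¹ • (1 - p)) = 1 - p := by
      rw [hcp, sub_mul, mul_smul_comm, mul_smul_comm, mul_assoc c, mul_sub p, mul_one, hp, sub_self,
        mul_zero, smul_zero, sub_zero, Algebra.algebraMap_eq_smul_one, smul_mul_assoc, one_mul,
        inv_smul_smul₀ hz0]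
    rw [mul_add, h4, h5, add_sub_cancel]
  · have h4 : v * p * (algebraMap ℂ A z - p * c) = p := by
      calc _ = v * (algebraMap ℂ A z - c) * p := by
            rw [mul_assoc, mul_assoc, mul_sub, sub_mul, ← mul_assoc p, hp, hcp, Algebra.commutes z p]
        _ = p := by rw [h3, one_mul]
    have h5 : (z⁻¹ • (1 - p)) * (algebraMap ℂ A z - p * c) = 1 - p := by
      rw [smul_mul_assoc, mul_sub, ← mul_assoc, sub_mul 1 p p, one_mul, hp, sub_self, zero_mul,
        sub_zero, Algebra.algebraMap_eq_smul_one, mul_smul_comm, mul_one, inv_smul_smul₀ hz0]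
    rw [add_mul, h4, h5, add_sub_cancel]

/-- `p * b - z` acts as `b - z` on the `p` part and as the scalar `-z` on the rest, so its
generalized Drazin inverse is `p * w - z⁻¹ • (1 - p)`. -/
theorem mul_mem_acc {b p : A} (hb : b ∈ acc A) (hp : p * p = p) (hpb : p * b = b * p) :
    p * b ∈ acc A := by
  intro z hz
  obtain ⟨w, hw⟩ := hb z hz
  have hpd : Commute p (b - algebraMap ℂ A z) :=
    (show Commute p b from hpb).sub_right (Algebra.commutes z p).symm
  have hwp : Commute p w := hw.mem_bicommutant p (by rintro _ rfl; exact hpd.symm.eq)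
  obtain ⟨h1, h2, h3⟩ := hw
  set d := b - algebraMap ℂ A z with hd
  clear_value d
  have hdw : Commute d w := h1 d rfl
  set k : A := z⁻¹ • (1 - p) with hk
  have hpk : p * k = 0 := by rw [hk, mul_smul_comm, mul_sub, mul_one, hp, sub_self, smul_zero]
  have hkp : k * p = 0 := by
    rw [hk, smul_mul_assoc, sub_mul, one_mul, hp, sub_self, smul_zero]
  have hzk : algebraMap ℂ A z * k = 1 - p := by
    rw [hk, Algebra.algebraMap_eq_smul_one, smul_mul_assoc, one_mul, smul_inv_smul₀ hz]
  have hbz : p * b - algebraMap ℂ A z = p * d - algebraMap ℂ A z * (1 - p) := by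
    rw [hd, mul_sub p, mul_sub, mul_one, Algebra.commutes z p]; abel
  have hd' : (p * b - algebraMap ℂ A z) * (p * w - k) = p * (d * w) + (1 - p) := by
    have e1 : (p * d) * (p * w) = p * (d * w) := by
      rw [mul_assoc, ← mul_assoc d, ← hpd.eq, mul_assoc, ← mul_assoc p, hp]
    have e2 : (p * d) * k = 0 := by rw [hpd.eq, mul_assoc, hpk, mul_zero]
    have e3 : (1 - p) * (p * w) = 0 := by rw [← mul_assoc, sub_mul, one_mul, hp, sub_self, zero_mul]
    have e4 : (1 - p) * k = k := by rw [sub_mul, hpk, one_mul, sub_zero]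
    rw [hbz, sub_mul, mul_sub, mul_sub, e1, e2, mul_assoc _ (1 - p), mul_assoc _ (1 - p), e3, e4,
      hzk, sub_zero, mul_zero, zero_sub, sub_neg_eq_add]
  have hd'' : (p * w - k) * (p * b - algebraMap ℂ A z) = p * (d * w) + (1 - p) := by
    rw [← hd']
    have c1 : Commute (p * w) (p * b - algebraMap ℂ A z) := by
      refine Commute.sub_right (Commute.mul_left ?_ ?_) (Algebra.commutes z _).symm
      · exact (Commute.refl p).mul_right hpb
      · have : b = d + algebraMap ℂ A z := by rw [hd, sub_add_cancel]
        rw [this]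
        exact hwp.symm.mul_right (hdw.symm.add_right (Algebra.commutes z w).symm)
    have c2 : Commute k (p * b - algebraMap ℂ A z) := by
      refine Commute.sub_right ?_ (Algebra.commutes z _).symm
      rw [commute_iff_eq, ← mul_assoc, hkp, hpb, mul_assoc, hpk, zero_mul, mul_zero]
    exact (c1.sub_left c2).eq
  refine ⟨p * w - k, ?_, ?_, ?_⟩
  · rintro _ rfl
    rw [hd', hd'']
  · have e1 : p * (d * w) * (p * w) = p * w := by
      rw [hwp.eq, ← mul_assoc, mul_assoc p, mul_assoc d w w, ← mul_assoc d, hdw.eq, h2, hwp.eq, mul_assoc, hp]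
    have e2 : p * (d * w) * k = 0 := by
      rw [(hpd.mul_right hwp).eq, mul_assoc, hpk, mul_zero]
    have e3 : (1 - p) * (p * w) = 0 := by rw [← mul_assoc, sub_mul, one_mul, hp, sub_self, zero_mul]
    have e4 : (1 - p) * k = k := by rw [sub_mul, hpk, one_mul, sub_zero]
    rw [hd'', mul_sub, add_mul, add_mul, e1, e2, e3, e4]
    simp
  · have : p * b - algebraMap ℂ A z - (p * b - algebraMap ℂ A z) ^ 2 * (p * w - k)
        = p * (d - d ^ 2 * w) := by
      rw [sq, mul_assoc, hd', hbz]
      have e1 : p * d * (p * (d * w)) = p * (d ^ 2 * w) := by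
        rw [mul_assoc, ← mul_assoc d, ← hpd.eq, mul_assoc, ← mul_assoc p, hp, sq, mul_assoc d d w]
      have e2 : p * d * (1 - p) = 0 := by
        rw [hpd.eq, mul_assoc, mul_sub, mul_one, hp, sub_self, mul_zero]
      have e3 : (1 - p) * (p * (d * w)) = 0 := by
        rw [← mul_assoc, sub_mul, one_mul, hp, sub_self, zero_mul]
      have e4 : (1 - p) * (1 - p) = 1 - p := IsIdempotentElem.one_sub hp
      rw [sub_mul, mul_add, mul_add, e1, e2, mul_assoc _ (1 - p), mul_assoc _ (1 - p), e3, e4,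
        mul_sub p]
      simp
    rw [this]
    refine mul_mem_qnil h3 hp ?_
    exact (hpd.sub_right ((hpd.pow_right 2).mul_right hwp)).eq

theorem exists_mem_bicommutant {a x : A} (h : IsAGDrazinInverse a x) :
    ∃ p : A, p * p = p ∧ p ∈ Set.centralizer (Set.centralizer {a}) ∧
      IsUnit (a + p) ∧ p * (a * x) = 0 := by
  obtain ⟨hx, hxax, hacc⟩ := h
  have hax : a * x = x * a := hx a rfl
  let S : Set A := {a, x}
  have hS : ∀ u ∈ S, ∀ v ∈ S, u * v = v * u := by
    rintro u (rfl | rfl) v (rfl | rfl)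
    exacts [rfl, hax, hax.symm, rfl]
  let _ : NormedCommRing (bicommutant S) :=
    { (inferInstance : NormedRing (bicommutant S)) with
      mul_comm := fun u v => Subtype.ext
        (Set.centralizer_centralizer_comm_of_comm hS u u.2 v v.2) }
  have : CompleteSpace (bicommutant S) :=
    (Set.isClosed_centralizer S.centralizer).completeSpace_coe
  let a' : bicommutant S := ⟨a, Set.subset_centralizer_centralizer (.inl rfl)⟩
  let x' : bicommutant S := ⟨x, Set.subset_centralizer_centralizer (.inr rfl)⟩
  obtain ⟨p, y, hp, hya, hpax, hu, hlim⟩ := exists_idempotent_tendsto (a := a') (x := x')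
    (Subtype.ext hxax) fun z hz => by
      obtain ⟨w, hw⟩ := hacc z hz
      let d' : bicommutant S := a' - a' ^ 2 * x' - algebraMap ℂ _ z
      have hwB : w ∈ bicommutant S := by
        -- `w` double-commutes with `d'`, which lies in the double commutant of `S`; hence so does
        -- `w`.
        have h1 : S.centralizer ⊆ Set.centralizer {(d' : A)} := by
          rintro c hc _ rfl
          exact (d'.2 c hc).symm
        exact Set.centralizer_subset h1 hw.mem_bicommutant
      exact ⟨⟨w, hwB⟩, Subtype.ext hw.2.1, fun φ =>
        algHom_eq_zero_of_mem_qnil (b := d' - d' ^ 2 * ⟨w, hwB⟩) hw.2.2 φ⟩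
  refine ⟨p, congrArg Subtype.val hp, ?_, hu.map (bicommutant S).val, congrArg Subtype.val hpax⟩
  exact mem_bicommutant_of_tendsto (y := y) (congrArg Subtype.val hp)
    (congrArg Subtype.val (mul_comm a' p)) (congrArg Subtype.val hya)
    (congrArg Subtype.val ((mul_comm a' y).trans hya)) hlim

end Ring

/-- The inverse of `a + p` is an ag-Drazin inverse of `a` on the complement of `p`. -/
theorem isAGDrazinInverse_inverse_mul {A : Type*} [Ring A] [Algebra ℂ A] {a p : A}
    (hp : p * p = p) (hpa : p ∈ Set.centralizer {a}) (hu : IsUnit (a + p))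
    (hacc : a * p ∈ acc A) : IsAGDrazinInverse a (Ring.inverse (a + p) * (1 - p)) := by
  have hap : Commute a p := hpa a rfl
  obtain ⟨u, hu⟩ := hu
  rw [← hu, Ring.inverse_unit]
  have hau : Commute a (↑u⁻¹ : A) := by
    have : Commute a (u : A) := by
      rw [hu]
      exact (Commute.refl a).add_right hap
    exact this.units_inv_right
  have hax : Commute a (↑u⁻¹ * (1 - p)) := hau.mul_right ((Commute.one_right a).sub_right hap)
  have h1 : ↑u⁻¹ * (1 - p) * a = 1 - p := by
    have h2 : (1 - p) * a = u * (1 - p) := by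
      rw [hu, sub_mul, mul_sub, one_mul, mul_one, add_mul, hp, hap.eq]
      abel
    rw [mul_assoc, h2, Units.inv_mul_cancel_left]
  refine ⟨?_, ?_, ?_⟩
  · rintro _ rfl
    exact hax.eq
  · rw [h1, ← mul_assoc, ((Commute.one_right (↑u⁻¹ : A)).sub_right ?_).symm.eq, mul_assoc,
      IsIdempotentElem.one_sub hp]
    have : Commute p (u : A) := by
      rw [hu]
      exact hap.symm.add_right (Commute.refl p)
    exact this.units_inv_right.symm
  · rw [sq, mul_assoc, hax.eq, h1, mul_sub, mul_one, sub_sub_cancel]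
    exact hacc

end AGDrazin

theorem mainTheorem3 {A : Type*} [NormedRing A] [NormedAlgebra ℂ A] [CompleteSpace A] (a : A) :
    List.TFAE
      [ a ∈ AGDrazin.agDrazin A,
        ∃ p : A, IsIdempotentElem p ∧ p ∈ Set.centralizer (Set.centralizer {a}) ∧
          IsUnit (a + p) ∧ a * p ∈ AGDrazin.acc A,
        ∃ p : A, IsIdempotentElem p ∧ p ∈ Set.centralizer {a} ∧
          IsUnit (a + p) ∧ a * p ∈ AGDrazin.acc A ] ∧
    ∀ p : A, IsIdempotentElem p → p ∈ Set.centralizer {a} →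
      IsUnit (a + p) → a * p ∈ AGDrazin.acc A →
        AGDrazin.IsAGDrazinInverse a (Ring.inverse (a + p) * (1 - p)) := by
  have hmem : ∀ p ∈ Set.centralizer (Set.centralizer {a}), p ∈ Set.centralizer {a} := by
    rintro p hp _ rfl
    exact hp _ (by rintro _ rfl; rfl)
  refine ⟨?_, fun p hp hpa hu hacc => AGDrazin.isAGDrazinInverse_inverse_mul hp hpa hu hacc⟩
  tfae_have 1 → 2 := by
    rintro ⟨x, hx⟩
    obtain ⟨p, hp, hpa, hu, hpax⟩ := AGDrazin.exists_mem_bicommutant hx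
    have hap : Commute a p := hmem p hpa a rfl
    have hxp : Commute x p := hpa x hx.1
    have hpb : p * (a - a ^ 2 * x) = a * p := by
      rw [mul_sub, sq, mul_assoc, ← mul_assoc p, ← hap.eq, mul_assoc a p, hpax, mul_zero, sub_zero]
    refine ⟨p, hp, hpa, hu, ?_⟩
    rw [← hpb]
    exact AGDrazin.mul_mem_acc hx.2.2 hp
      (hap.symm.sub_right ((hap.symm.pow_right 2).mul_right hxp.symm)).eq
  tfae_have 2 → 3 := by
    rintro ⟨p, hp, hpa, h⟩
    exact ⟨p, hp, hmem p hpa, h⟩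
  tfae_have 3 → 1 := by
    rintro ⟨p, hp, hpa, hu, hacc⟩
    exact ⟨_, AGDrazin.isAGDrazinInverse_inverse_mul hp hpa hu hacc⟩
  tfae_finish
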